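/- **Setting.** Let $n\ge 1$ and $p\ge n$ be integers, and let $t_{-1}\le t_0\le\dots\le t_{p+n+1}\le t_{p+n+2}$ be real knots with $t_n<t_{n+1}$ and $t_p<t_{p+1}$. For a knot sequence $\kappa$, let $N^d_{i,\kappa}$ be the normalized B-spline basis functions of degree $d$ (Cox–de Boor recursion with $0/0=0$, half-open knot intervals). Splines are considered on $[t_n,t_{p+1}]$; their values at $t_{p+1}$ are the limits from the left. Put $$\mu=\{t_i\}_{i=0}^{p+n+1},\qquad \nu=\{s_i\}_{i=0}^{(p+n+2)(n+1)-1}=\{\langle t_i\rangle^{n+1}\}_{i=0}^{p+n+1},\qquad \rho=\{s'_i\}_{i=0}^{(p+n+2)(n+1)+1}=\{t_{-1},\{\langle t_i\rangle^{n+1}\}_{i=0}^{p+n+1},t_{p+n+2}\},$$ where $\langle t\rangle^{k}$ denotes a knot repeated $k$ times, so that $s'_i=s_{i-1}$ for $1\le i\le (p+n+2)(n+1)$. Let $z(t)=\sum_{i=0}^p z_iN^n_{i,\mu}(t)$ with $z_i\in\mathbb C$, let $q=(n+1)(p+n)$, and let $p_0,\dots,p_q\in\mathbb C$ be coefficients with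 $$z(t)^2=\sum_{k=0}^q p_kN^{2n}_{k,\nu}(t),\qquad t\in[t_n,t_{p+1}].$$ The associated PH B-spline curve of degree $2n+1$ is $$r(t)=\sum_{i=0}^{q+1}r_iN^{2n+1}_{i,\rho}(t),\quad t\in[t_n,t_{p+1}],\qquad r_{i+1}=r_i+\frac{s_{i+2n+1}-s_i}{2n+1}\,p_i\quad(0\le i\le q),\quad r_0\in\mathbb C\ \text{arbitrary}.$$ Let $B^d_k(x)=\binom dk x^k(1-x)^{d-k}$ be the Bernstein polynomials. **(a)** Let $p=m\ge n$. Call $r$ clamped if $$r(t_n)=r_0,\quad r(t_{m+1})=r_{q+1},\quad r'(t_n)=\tfrac{2n+1}{s'_{2n+2}-s'_1}(r_1-r_0),\quad r'(t_{m+1})=\tfrac{2n+1}{s'_{q+2n+2}-s'_{q+1}}(r_{q+1}-r_q),$$ with one-sided derivatives; if $s'_{2n+2}=s'_1$ (respectively $s'_{q+2n+2}=s'_{q+1}$), the right-hand side, then of the form $0/0$, is read as $p_0$ (respectively $p_q$). Then $r$ is clamped if and only if, with $$\alpha=\frac{t_n-t_{n-1}}{t_{n+1}-t_{n-1}},\qquad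 \beta=\frac{t_{m+1}-t_m}{t_{m+2}-t_m},$$ one has $$\sum_{k=0}^n r_{(n-1)(n+1)+k+1}B^n_k(\alpha)=r_0,\qquad \sum_{k=0}^{n-1}p_{(n-1)(n+1)+k+1}B^{n-1}_k(\alpha)=p_0,$$ $$\sum_{k=0}^n r_{m(n+1)+k+1}B^n_k(\beta)=r_{q+1},\qquad \sum_{k=0}^{n-1}p_{m(n+1)+k+1}B^{n-1}_k(\beta)=p_q.$$ **(b)** Let $p=m+n$ with $m\ge 0$, and assume that the knot spacings satisfy $$t_{m+1+k}-t_{m+k}=t_k-t_{k-1}\qquad\text{for } k=n,\,n+1.$$ Then $r$ is closed, $r(t_n)=r(t_{m+n+1})$, and of class $C^n$ at this junction point (the periodic extension of $r$ with period $t_{m+n+1}-t_n$ is $C^n$ at $t_n$) if and only if $$\sum_{j=n(n+1)-k}^{(m+n+1)(n+1)-k-1}(s_{j+2n+1}-s_j)\,p_j=0\qquad\text{for } k=0,\dots,n.$$ In particular, the knot condition and the vanishing of these sums together suffice for $r$ to be closed and $C^n$ at the junction. -/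

import Mathlib

open scoped BigOperators

noncomputable section

/-- Normalized B-spline basis functions `N_i^k` over the knot sequence `u` (Cox-de Boor recursion,
with `0/0 = 0`, which is Lean's convention for division).
The knot intervals `[u_i, u_{i+1})` are half open, except that at the right end `b` of the
parameter domain the interval ending there is taken to be closed, as is usual. So a spline is
right continuous at every `x ≠ b`, and its value at `b` is its limit from within the domain.
(If a spline is continuous at `b`, this agrees with the half open convention.) -/
def bsplineBasis (u : ℤ → ℝ) (b : ℝ) : ℕ → ℤ → ℝ → ℝ
  | 0, i, x =>
      open Classical in
      if x = b then (if u i < x ∧ x ≤ u (i + 1) then 1 else 0)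
      else (if u i ≤ x ∧ x < u (i + 1) then 1 else 0)
  | k + 1, i, x =>
      (x - u i) / (u (i + k + 1) - u i) * bsplineBasis u b k i x +
      (u (i + k + 2) - x) / (u (i + k + 2) - u (i + 1)) * bsplineBasis u b k (i + 1) x

/-- The planar B-spline curve `∑_{i=0}^{M} c_i N_i^d(x)`; the plane is identified with `ℂ`. -/
def bsplineCurve (u : ℤ → ℝ) (b : ℝ) (d M : ℕ) (c : ℕ → ℂ) (x : ℝ) : ℂ :=
  ∑ i ∈ Finset.range (M + 1), bsplineBasis u b d (i : ℤ) x • c i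

/-- The knots `s_i` of `ν = {<t_k>^{n+1}}_k`: every knot of `t` is repeated `n + 1` times
(`s_0 = ⋯ = s_n = t_0`, `s_{n+1} = ⋯ = s_{2n+1} = t_1`, ...; `/` is floor division on `ℤ`). -/
def knotsNu (n : ℕ) (t : ℤ → ℝ) (i : ℤ) : ℝ := t (i / ((n : ℤ) + 1))

/-- The knots `s'_i` of `ρ = {t_{-1}, {<t_k>^{n+1}}_{k=0,...,p+n+1}, t_{p+n+2}}`, that is
`s'_i = s_{i-1}`; in particular `s'_0 = t_{-1}` and `s'_{(p+n+2)(n+1)+1} = t_{p+n+2}`.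
Only the indices `0, ..., (p+n+2)(n+1)+1` are ever used. -/
def knotsRho (n : ℕ) (t : ℤ → ℝ) (i : ℤ) : ℝ := t ((i - 1) / ((n : ℤ) + 1))

/-- The data of a PH B-spline curve of degree `2n+1`. The knots `t_i` are indexed by `ℤ`; only
`t_{-1}, ..., t_{p+n+2}` are relevant. Repeated knots are allowed, except that the first and the
last knot interval of the parameter domain `[t_n, t_{p+1}]` are nondegenerate. -/
structure PHBSpline (n p : ℕ) where
  /-- knots -/
  t : ℤ → ℝ
  mono : Monotone t
  start_lt : t n < t (n + 1)
  end_lt : t p < t (p + 1)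
  /-- control points `z_0, ..., z_p` of the degree `n` spline `z` over the knots `t` -/
  zc : ℕ → ℂ
  /-- control points `p_0, ..., p_q`, `q = (n+1)(p+n)`, of `z²` as a degree `2n` spline over `ν` -/
  pc : ℕ → ℂ
  sq : ∀ x ∈ Set.Icc (t n) (t (p + 1)),
    bsplineCurve (knotsNu n t) (t (p + 1)) (2 * n) ((n + 1) * (p + n)) pc x =
      (bsplineCurve t (t (p + 1)) n p zc x) ^ 2
  /-- the constant of integration -/
  r0 : ℂ

namespace PHBSpline

variable {n p : ℕ} (C : PHBSpline n p)

/-- Left end `t_n` of the parameter domain. -/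
def a : ℝ := C.t n

/-- Right end `t_{p+1}` of the parameter domain. -/
def b : ℝ := C.t (p + 1)

/-- `q = (n+1)(p+n)`. -/
def q (_C : PHBSpline n p) : ℕ := (n + 1) * (p + n)

/-- The knots `s_i` of `ν`. -/
def s (i : ℤ) : ℝ := knotsNu n C.t i

/-- The knots `s'_i` of `ρ`. -/
def s' (i : ℤ) : ℝ := knotsRho n C.t i

/-- Control points of the integrated curve:
`r_{i+1} = r_i + (s_{i+2n+1} - s_i) / (2n+1) p_i` with `r_0` arbitrary. -/
def rc : ℕ → ℂ
  | 0 => C.r0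
  | i + 1 => rc i + ((C.s (i + 2 * n + 1) - C.s i) / (2 * n + 1) : ℝ) • C.pc i

/-- The PH B-spline curve `r(x) = ∑_{i=0}^{q+1} r_i N_{i,ρ}^{2n+1}(x)`. -/
def r (x : ℝ) : ℂ := bsplineCurve C.s' C.b (2 * n + 1) (C.q + 1) C.rc x

/-- The vector `(2n+1) / (s'_{i+2n+2} - s'_{i+1}) (r_{i+1} - r_i)` on the `i`-th leg of the control
polygon. For `s'_{i+2n+2} = s'_{i+1}` that quotient has the form `0/0`, and it is read as `p_i`,
which is its value for all other `i`. -/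
def legVector (i : ℕ) : ℂ :=
  open Classical in
  if C.s' (i + 2 * n + 2) = C.s' (i + 1) then C.pc i
  else ((2 * n + 1) / (C.s' (i + 2 * n + 2) - C.s' (i + 1)) : ℝ) • (C.rc (i + 1) - C.rc i)

/-- `r` is clamped: end point interpolation and tangency to the end legs of the control polygon
(derivatives at the ends of the parameter domain are one-sided). -/
def IsClamped : Prop :=
  C.r C.a = C.rc 0 ∧ C.r C.b = C.rc (C.q + 1) ∧
  HasDerivWithinAt C.r (C.legVector 0) (Set.Icc C.a C.b) C.a ∧
  HasDerivWithinAt C.r (C.legVector C.q) (Set.Icc C.a C.b) C.b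

/-- `r` is closed and of class `C^n` at the junction point `r(a) = r(b)`: the curve that arrives
at the parameter `a` along the end of `r` (shifted by the period `b - a`) and leaves it along the
beginning of `r`, that is, the periodic extension of `r` near `a`, is `C^n` at `a`. -/
def IsClosedSmooth : Prop :=
  C.r C.a = C.r C.b ∧
  ContDiffAt ℝ n (fun x => if x < C.a then C.r (x + (C.b - C.a)) else C.r x) C.a

end PHBSpline

end

/-! Each end of the parameter domain is a knot `τ` that `ρ` repeats `n + 1` times, with `n + 1`
copies of its neighbours `A` and `B` on either side. At such a knot the Cox–de Boor recursion
collapses. Up to degree `n + 1` exactly one basis function is nonzero at `τ`. From there to degree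
`2n + 1` every denominator that matters is `B - A`, so the recursion is de Casteljau's, and the
values are Bernstein polynomials at `(τ - A) / (B - A)` (`IsKnotCluster.pieceBasis_eq`). Hence
`r(τ)` is a Bernstein combination of `n + 1` control points. As the relevant control points of `r'`
are the `p_i`, `r'(τ)` is one of `n` of these. This gives (a). For (b), differentiation near `τ`
replaces control points by their differences times a common factor, so the `n`-jet at `τ` and the `n
+ 1` control points there determine each other (`IsKnotCluster.iteratedDeriv_eq_iff`). The spacing
condition makes parameter and factor equal at both ends. Smooth closure therefore means pairwise
equality of these control points, and their differences telescope to the given sums. -/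

open Filter Topology

/-! ### Polynomial pieces of splines on a single knot interval -/

/-- The polynomials which the B-spline basis functions over `u` agree with on the knot interval
between `u J` and `u (J + 1)`. -/
noncomputable def pieceBasis (u : ℤ → ℝ) (J : ℤ) : ℕ → ℤ → ℝ → ℝ
  | 0, i, _ => if i = J then 1 else 0
  | k + 1, i, x =>
      (x - u i) / (u (i + k + 1) - u i) * pieceBasis u J k i x +
      (u (i + k + 2) - x) / (u (i + k + 2) - u (i + 1)) * pieceBasis u J k (i + 1) x

/-- The polynomial which a spline curve agrees with on a knot interval. -/
noncomputable def pieceCurve (u : ℤ → ℝ) (J : ℤ) (d M : ℕ) (c : ℕ → ℂ) (x : ℝ) : ℂ :=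
  ∑ i ∈ Finset.range (M + 1), pieceBasis u J d (i : ℤ) x • c i

/-- The control points of the derivative of a spline of degree `d`. -/
noncomputable def derivCoeff (u : ℤ → ℝ) (d : ℕ) (c : ℕ → ℂ) (i : ℕ) : ℂ :=
  (d / (u (i + d) - u i) : ℝ) • (c i - c (i - 1))

theorem bsplineBasis_eq_pieceBasis {u : ℤ → ℝ} (hu : Monotone u) {b x : ℝ} {J : ℤ}
    (h : (x = b ∧ u J < x ∧ x ≤ u (J + 1)) ∨ (x ≠ b ∧ u J ≤ x ∧ x < u (J + 1))) (d : ℕ) (i : ℤ) :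
    bsplineBasis u b d i x = pieceBasis u J d i x := by
  induction d generalizing i with
  | zero =>
    have key : ∀ i : ℤ, i ≠ J → i + 1 ≤ J ∨ J + 1 ≤ i := fun i hi => by omega
    rcases h with ⟨h1, h2, h3⟩ | ⟨h1, h2, h3⟩
    · by_cases hi : i = J
      · subst hi
        simp only [bsplineBasis, pieceBasis, if_pos h1, if_pos (And.intro h2 h3), if_true]
      · have : ¬ (u i < x ∧ x ≤ u (i + 1)) := by
          rintro ⟨h4, h5⟩
          rcases key i hi with h6 | h6
          · linarith [hu h6]
          · linarith [hu h6]
        simp only [bsplineBasis, pieceBasis, if_pos h1, if_neg this, if_neg hi]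
    · by_cases hi : i = J
      · subst hi
        simp only [bsplineBasis, pieceBasis, if_neg h1, if_pos (And.intro h2 h3), if_true]
      · have : ¬ (u i ≤ x ∧ x < u (i + 1)) := by
          rintro ⟨h4, h5⟩
          rcases key i hi with h6 | h6
          · linarith [hu h6]
          · linarith [hu h6]
        simp only [bsplineBasis, pieceBasis, if_neg h1, if_neg this, if_neg hi]
  | succ d ih => simp only [bsplineBasis, pieceBasis, ih]

theorem bsplineCurve_eq_pieceCurve {u : ℤ → ℝ} (hu : Monotone u) {b x : ℝ} {J : ℤ}
    (h : (x = b ∧ u J < x ∧ x ≤ u (J + 1)) ∨ (x ≠ b ∧ u J ≤ x ∧ x < u (J + 1))) (d M : ℕ)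
    (c : ℕ → ℂ) : bsplineCurve u b d M c x = pieceCurve u J d M c x := by
  simp only [bsplineCurve, pieceCurve, bsplineBasis_eq_pieceBasis hu h]

theorem pieceBasis_of_gt (u : ℤ → ℝ) {J : ℤ} (d : ℕ) {i : ℤ} (h : J < i) (x : ℝ) :
    pieceBasis u J d i x = 0 := by
  induction d generalizing i with
  | zero => simp [pieceBasis, h.ne']
  | succ d ih => simp [pieceBasis, ih h, ih (show J < i + 1 by omega)]

theorem pieceBasis_of_lt (u : ℤ → ℝ) {J : ℤ} (d : ℕ) {i : ℤ} (h : i + d < J) (x : ℝ) :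
    pieceBasis u J d i x = 0 := by
  induction d generalizing i with
  | zero => simp only [pieceBasis]; rw [if_neg (by push_cast at h; omega)]
  | succ d ih =>
    push_cast at h
    simp [pieceBasis, ih (show i + d < J by omega), ih (show i + 1 + d < J by omega)]

/-! ### Derivatives of the pieces -/

/-- The recurrence behind `hasDerivAt_pieceBasis_succ`, where `α`, `β`, `γ` are three consecutive
basis functions divided by the lengths of their supports. -/
theorem bspline_deriv_recurrence {x d u0 u1 v1 v2 α β γ : ℝ}
    (hβ₀ : v1 - u0 = 0 → β = 0) (hβ₂ : v2 - u1 = 0 → β = 0) :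
    (1 / (v1 - u0) * ((x - u0) * α + (v1 - x) * β) + (x - u0) / (v1 - u0) * ((d + 1) * (α - β))) +
      (-1 / (v2 - u1) * ((x - u1) * β + (v2 - x) * γ) +
        (v2 - x) / (v2 - u1) * ((d + 1) * (β - γ))) =
    (d + 1 + 1) * (((x - u0) * α + (v1 - x) * β) / (v1 - u0) -
      ((x - u1) * β + (v2 - x) * γ) / (v2 - u1)) := by
  by_cases h0 : v1 - u0 = 0 <;> by_cases h2 : v2 - u1 = 0
  · simp [h0, h2]
  · rw [hβ₀ h0, h0]; field_simp; ring
  · rw [hβ₂ h2, h2]; field_simp; ring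
  · field_simp; ring

theorem hasDerivAt_pieceBasis_succ {u : ℤ → ℝ} (hu : Monotone u) (J : ℤ) (d : ℕ) (i : ℤ) (x : ℝ) :
    HasDerivAt (pieceBasis u J (d + 1) i)
      ((d + 1) * (pieceBasis u J d i x / (u (i + d + 1) - u i) -
        pieceBasis u J d (i + 1) x / (u (i + d + 2) - u (i + 1)))) x := by
  induction d generalizing i with
  | zero =>
    have h1 : HasDerivAt (fun x : ℝ => (x - u i) / (u (i + (0 : ℕ) + 1) - u i) *
        pieceBasis u J 0 i x) (1 / (u (i + (0 : ℕ) + 1) - u i) * pieceBasis u J 0 i x) x :=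
      ((((hasDerivAt_id x).sub_const _).div_const _).mul_const _)
    have h2 : HasDerivAt (fun x : ℝ => (u (i + (0 : ℕ) + 2) - x) /
        (u (i + (0 : ℕ) + 2) - u (i + 1)) * pieceBasis u J 0 (i + 1) x)
        (-1 / (u (i + (0 : ℕ) + 2) - u (i + 1)) * pieceBasis u J 0 (i + 1) x) x :=
      ((((hasDerivAt_id x).const_sub _).div_const _).mul_const _)
    refine (h1.add h2).congr_deriv ?_
    push_cast
    ring
  | succ d ih =>
    have h1 : HasDerivAt (fun x : ℝ => (x - u i) / (u (i + (d + 1 : ℕ) + 1) - u i) *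
        pieceBasis u J (d + 1) i x) _ x :=
      ((((hasDerivAt_id x).sub_const _).div_const _).mul (ih i))
    have h2 : HasDerivAt (fun x : ℝ => (u (i + (d + 1 : ℕ) + 2) - x) /
        (u (i + (d + 1 : ℕ) + 2) - u (i + 1)) * pieceBasis u J (d + 1) (i + 1) x) _ x :=
      ((((hasDerivAt_id x).const_sub _).div_const _).mul (ih (i + 1)))
    refine (h1.add h2).congr_deriv ?_
    have e1 : i + ((d + 1 : ℕ) : ℤ) + 1 = i + d + 2 := by push_cast; ring
    have e2 : i + ((d + 1 : ℕ) : ℤ) + 2 = i + d + 3 := by push_cast; ring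
    have e3 : i + 1 + (d : ℤ) + 1 = i + d + 2 := by ring
    have e4 : i + 1 + (d : ℤ) + 2 = i + d + 3 := by ring
    have e5 : i + 1 + 1 = i + 2 := by ring
    simp only [pieceBasis, e1, e2, e3, e4, e5, id, div_mul_eq_mul_div, mul_div_assoc]
    push_cast
    have m1 : u i ≤ u (i + 1) := hu (by omega)
    have m2 : u (i + 1) ≤ u (i + d + 2) := hu (by omega)
    have m3 : u (i + d + 2) ≤ u (i + d + 3) := hu (by omega)
    -- The middle support lies inside both of its larger neighbours, so if either of those has
    -- length zero it does too, and `x / 0 = 0` makes its normalized function vanish.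
    have hβ : u (i + d + 2) - u (i + 1) = 0 →
        pieceBasis u J d (i + 1) x / (u (i + d + 2) - u (i + 1)) = 0 := fun h => by simp [h]
    have := bspline_deriv_recurrence (x := x) (d := d) (u0 := u i) (u1 := u (i + 1))
      (v1 := u (i + d + 2)) (v2 := u (i + d + 3))
      (α := pieceBasis u J d i x / (u (i + d + 1) - u i))
      (β := pieceBasis u J d (i + 1) x / (u (i + d + 2) - u (i + 1)))
      (γ := pieceBasis u J d (i + 2) x / (u (i + d + 3) - u (i + 2)))
      (fun h => hβ (by linarith)) (fun h => hβ (by linarith))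
    convert this using 1
    ring

/-- Summation by parts applied to the derivative formula for the basis. The bounds on `J` make both
boundary terms vanish; in particular the truncated `c (0 - 1)` is multiplied by `w 0 = 0`. -/
theorem hasDerivAt_pieceCurve_succ {u : ℤ → ℝ} (hu : Monotone u) {J : ℤ} {d M : ℕ}
    (hd : (d : ℤ) + 1 ≤ J) (hM : J ≤ M) (c : ℕ → ℂ) (x : ℝ) :
    HasDerivAt (pieceCurve u J (d + 1) M c)
      (pieceCurve u J d M (derivCoeff u (d + 1) c) x) x := by
  have h := HasDerivAt.fun_sum (u := Finset.range (M + 1)) (x := x) fun i _ =>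
    (hasDerivAt_pieceBasis_succ hu J d (i : ℤ) x).smul_const (c i)
  refine h.congr_deriv ?_
  unfold pieceCurve
  set w : ℕ → ℝ := fun i => pieceBasis u J d i x / (u (i + d + 1) - u i) with hw
  have w0 : w 0 = 0 := by
    simp only [hw]; rw [pieceBasis_of_lt u d (by push_cast; omega), zero_div]
  have wM : w (M + 1) = 0 := by
    simp only [hw]; rw [pieceBasis_of_gt u d (by push_cast; omega), zero_div]
  have l : ∀ i : ℕ, ((d + 1 : ℝ) * (pieceBasis u J d i x / (u (i + d + 1) - u i) -
        pieceBasis u J d (i + 1) x / (u (i + d + 2) - u (i + 1)))) • c i =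
      ((d + 1) * w i) • c i - ((d + 1) * w (i + 1)) • c i := fun i => by
    rw [← sub_smul, ← mul_sub]
    simp only [hw]
    push_cast
    rw [show (i : ℤ) + 1 + d + 1 = i + d + 2 by ring]
  have r : ∀ i : ℕ, pieceBasis u J d i x • derivCoeff u (d + 1) c i =
      ((d + 1) * w i) • c i - ((d + 1) * w i) • c (i - 1) := fun i => by
    rw [← smul_sub, derivCoeff, smul_smul]
    simp only [hw]
    push_cast
    rw [← add_assoc]
    congr 1
    ring
  rw [Finset.sum_congr rfl fun i _ => l i, Finset.sum_congr rfl fun i _ => r i,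
    Finset.sum_sub_distrib, Finset.sum_sub_distrib, sub_right_inj,
    Finset.sum_range_succ, Finset.sum_range_succ' (fun i => ((d + 1) * w i) • c (i - 1))]
  simp [w0, wM]

theorem contDiff_pieceBasis (u : ℤ → ℝ) (J : ℤ) (d : ℕ) (i : ℤ) {m : WithTop ℕ∞} :
    ContDiff ℝ m (pieceBasis u J d i) := by
  induction d generalizing i with
  | zero => exact contDiff_const
  | succ d ih =>
    exact (((contDiff_id.sub contDiff_const).div_const _).mul (ih i)).add
      (((contDiff_const.sub contDiff_id).div_const _).mul (ih (i + 1)))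

theorem contDiff_pieceCurve (u : ℤ → ℝ) (J : ℤ) (d M : ℕ) (c : ℕ → ℂ) {m : WithTop ℕ∞} :
    ContDiff ℝ m (pieceCurve u J d M c) :=
  ContDiff.sum fun i _ => (contDiff_pieceBasis u J d i).smul contDiff_const

/-! ### Values at a knot with `n + 1` copies -/

/-- The knots next to `τ` are `n + 1` copies of each of `A`, `τ`, `B`, where `K` is the last index
of `A`. -/
structure IsKnotCluster (u : ℤ → ℝ) (n : ℕ) (K : ℤ) (A τ B : ℝ) : Prop where
  left : ∀ j : ℤ, 0 ≤ j → j ≤ n → u (K - j) = A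
  mid : ∀ j : ℤ, 0 ≤ j → j ≤ n → u (K + 1 + j) = τ
  right : ∀ j : ℤ, 0 ≤ j → j ≤ n → u (K + n + 2 + j) = B
  lt : A < B

namespace IsKnotCluster

variable {u : ℤ → ℝ} {n : ℕ} {K : ℤ} {A τ B : ℝ}

/-- Here `K + n + 1` is the last copy of `τ`, so the piece starts at `τ`. Each rise in degree kills
the current function through its factor `x - u i` and passes the value 1 to the index below; the `n
+ 1` copies allow this to continue until index `K`. -/
theorem pieceBasis_right (h : IsKnotCluster u n K A τ B) (hτ : τ < B) {d : ℕ} (hd : d ≤ n + 1)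
    (i : ℤ) :
    pieceBasis u (K + n + 1) d i τ = if i = K + n + 1 - d then 1 else 0 := by
  induction d generalizing i with
  | zero => simp [pieceBasis]
  | succ d ih =>
    have hτ' : B - τ ≠ 0 := by linarith
    simp only [pieceBasis, ih (by omega)]
    push_cast
    have h1 := h.mid (n - d) (by omega) (by omega)
    have h2 := h.right 0 (by omega) (by omega)
    by_cases hi : i = K + n + 1 - d
    · rw [if_pos hi, if_neg (by omega), if_neg (by omega), hi,
        show K + n + 1 - (d : ℤ) = K + 1 + (n - d) by ring, h1]
      simp
    · rw [if_neg hi]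
      by_cases hi2 : i = K + n + 1 - (d + 1)
      · rw [if_pos (by omega), if_pos hi2, hi2,
          show K + n + 1 - ((d : ℤ) + 1) + d + 2 = K + n + 2 + 0 by ring,
          show K + n + 1 - ((d : ℤ) + 1) + 1 = K + 1 + (n - d) by ring, h1, h2, div_self hτ']
        simp
      · rw [if_neg (by omega), if_neg hi2]; simp

/-- Here the piece ends at `τ`, the factor `u (i + k + 2) - x` vanishes instead, and the value 1
stays at index `K`. From degree `n + 1` on, the pieces on both sides thus have the same starting
data. -/
theorem pieceBasis_left (h : IsKnotCluster u n K A τ B) (hτ : A < τ) {d : ℕ} (hd : d ≤ n + 1)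
    (i : ℤ) :
    pieceBasis u K d i τ = if i = K then 1 else 0 := by
  induction d generalizing i with
  | zero => simp [pieceBasis]
  | succ d ih =>
    have hτ' : τ - A ≠ 0 := by linarith
    simp only [pieceBasis, ih (by omega)]
    have h1 := h.mid d (by omega) (by omega)
    have h2 := h.left 0 (by omega) (by omega)
    rw [sub_zero] at h2
    by_cases hi : i = K
    · rw [if_pos hi, if_neg (by omega), hi, show K + (d : ℤ) + 1 = K + 1 + d by ring, h1, h2,
        div_self hτ']
      simp
    · rw [if_neg hi]
      by_cases hi2 : i + 1 = K
      · rw [if_pos hi2, show i + (d : ℤ) + 2 = K + 1 + d by omega, h1]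
        simp
      · rw [if_neg hi2]; simp

end IsKnotCluster

/-- The de Casteljau recursion, to which Cox–de Boor reduces at `τ` once all relevant supports reach
from `A` to `B`. -/
theorem bernsteinPolynomial_eval_succ_succ (l j : ℕ) (x : ℝ) :
    (bernsteinPolynomial ℝ (l + 1) (j + 1)).eval x =
      x * (bernsteinPolynomial ℝ l j).eval x + (1 - x) * (bernsteinPolynomial ℝ l (j + 1)).eval x := by
  rcases lt_trichotomy j l with h | h | h
  · obtain ⟨m, rfl⟩ := Nat.exists_eq_add_of_lt h
    simp only [bernsteinPolynomial, Nat.choose_succ_succ]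
    rw [show j + m + 1 + 1 - (j + 1) = m + 1 by omega, show j + m + 1 - j = m + 1 by omega,
      show j + m + 1 - (j + 1) = m by omega]
    simp
    ring
  · subst h
    simp [bernsteinPolynomial, pow_succ, mul_comm]
  · simp [bernsteinPolynomial, Nat.choose_eq_zero_of_lt, h, Nat.lt_succ_of_lt h]

theorem bernsteinPolynomial_eval_succ_zero (l : ℕ) (x : ℝ) :
    (bernsteinPolynomial ℝ (l + 1) 0).eval x = (1 - x) * (bernsteinPolynomial ℝ l 0).eval x := by
  simp [bernsteinPolynomial, pow_succ, mul_comm]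

namespace IsKnotCluster

variable {u : ℤ → ℝ} {n : ℕ} {K : ℤ} {A τ B : ℝ}

/-- Values at `τ` of the basis functions of degree `n + 1 + l`, on a knot interval `J` that has `τ`
as an end point. -/
theorem pieceBasis_eq (h : IsKnotCluster u n K A τ B) {J : ℤ}
    (hJ : ∀ i, pieceBasis u J (n + 1) i τ = if i = K then 1 else 0) {l : ℕ} (hl : l ≤ n) :
    (∀ i, i < K - l → pieceBasis u J (n + 1 + l) i τ = 0) ∧
    ∀ j : ℕ, pieceBasis u J (n + 1 + l) (K - l + j) τ =
      (bernsteinPolynomial ℝ l j).eval ((τ - A) / (B - A)) := by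
  have hAB : B - A ≠ 0 := by linarith [h.lt]
  induction l with
  | zero =>
    refine ⟨fun i hi => ?_, fun j => ?_⟩
    · rw [add_zero, hJ, if_neg (by push_cast at hi; omega)]
    · rw [add_zero, hJ]
      rcases j with _ | j
      · simp [bernsteinPolynomial]
      · rw [if_neg (by push_cast; omega)]
        simp [bernsteinPolynomial]
  | succ l ih =>
    obtain ⟨ih1, ih2⟩ := ih (by omega)
    rw [← add_assoc]
    refine ⟨fun i hi => ?_, fun j => ?_⟩
    · push_cast at hi
      simp [pieceBasis, ih1 i (by omega), ih1 (i + 1) (by omega)]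
    · have hα : 1 - (τ - A) / (B - A) = (B - τ) / (B - A) := by field_simp; ring
      have second : (u (K - (l + 1 : ℕ) + j + (n + 1 + l : ℕ) + 2) - τ) /
          (u (K - (l + 1 : ℕ) + j + (n + 1 + l : ℕ) + 2) - u (K - (l + 1 : ℕ) + j + 1)) *
          pieceBasis u J (n + 1 + l) (K - (l + 1 : ℕ) + j + 1) τ =
          (1 - (τ - A) / (B - A)) * (bernsteinPolynomial ℝ l j).eval ((τ - A) / (B - A)) := by
        rw [show K - ((l + 1 : ℕ) : ℤ) + j + 1 = K - l + j by push_cast; ring, ih2]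
        -- For `j > l` the knots may lie outside the cluster, but the Bernstein factor is then zero.
        rcases le_or_gt j l with hj | hj
        · rw [show K - ((l + 1 : ℕ) : ℤ) + j + (n + 1 + l : ℕ) + 2 = K + n + 2 + j by
              push_cast; ring, h.right j (by omega) (by omega),
            show K - (l : ℤ) + j = K - (l - j) by ring, h.left (l - j) (by omega) (by omega), hα]
        · simp [bernsteinPolynomial, Nat.choose_eq_zero_of_lt hj]
      rw [pieceBasis, second]
      rcases j with _ | j
      · rw [ih1 _ (by push_cast; omega), bernsteinPolynomial_eval_succ_zero]
        ring
      · rw [bernsteinPolynomial_eval_succ_succ,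
          show K - ((l + 1 : ℕ) : ℤ) + (j + 1 : ℕ) = K - l + j by push_cast; ring, ih2]
        congr 1
        rcases le_or_gt j l with hj | hj
        · rw [show K - (l : ℤ) + j + (n + 1 + l : ℕ) + 1 = K + n + 2 + j by push_cast; ring,
            h.right j (by omega) (by omega), show K - (l : ℤ) + j = K - (l - j) by ring,
            h.left (l - j) (by omega) (by omega)]
        · simp [bernsteinPolynomial, Nat.choose_eq_zero_of_lt hj]

theorem pieceCurve_eq {k : ℕ} (h : IsKnotCluster u n k A τ B) {J : ℤ}
    (hJ : ∀ i, pieceBasis u J (n + 1) i τ = if i = (k : ℤ) then 1 else 0) {l : ℕ} (hl : l ≤ n)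
    (hlk : l ≤ k) {M : ℕ} (hM : k ≤ M) (c : ℕ → ℂ) :
    pieceCurve u J (n + 1 + l) M c τ = ∑ j ∈ Finset.range (l + 1),
      (bernsteinPolynomial ℝ l j).eval ((τ - A) / (B - A)) • c (k - l + j) := by
  obtain ⟨h1, h2⟩ := h.pieceBasis_eq hJ hl
  rw [pieceCurve, show M + 1 = (k - l) + (M - k + (l + 1)) by omega, Finset.sum_range_add,
    Finset.sum_eq_zero, zero_add]
  · symm
    have e : ∀ j : ℕ, ((k - l + j : ℕ) : ℤ) = k - l + j := fun j => by push_cast [hlk]; ring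
    simp only [e, h2]
    apply Finset.sum_subset
    · intro j; simp only [Finset.mem_range]; omega
    · intro j _ hj
      simp only [Finset.mem_range, not_lt] at hj
      simp [bernsteinPolynomial, Nat.choose_eq_zero_of_lt (show l < j by omega)]
  · intro i hi
    rw [Finset.mem_range] at hi
    rw [h1 i (by omega), zero_smul]

end IsKnotCluster

/-! ### Jets at a repeated knot and control points -/

namespace IsKnotCluster

variable {u : ℤ → ℝ} {n : ℕ} {A τ B : ℝ}

/-- For these indices the knot difference always runs from a copy of `A` to a copy of `B`, so the
factor does not depend on `j`. -/
theorem derivCoeff_eq {k : ℕ} (h : IsKnotCluster u n k A τ B) {l : ℕ} (hl : l ≤ n) (hlk : l ≤ k)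
    (c : ℕ → ℂ) {j : ℕ} (hj : j ≤ l) :
    derivCoeff u (n + 1 + l + 1) c (k - l + j) =
      ((n + 1 + l + 1 : ℕ) / (B - A) : ℝ) • (c (k - l + j) - c (k - l + j - 1)) := by
  rw [derivCoeff,
    show ((k - l + j : ℕ) : ℤ) + ((n + 1 + l + 1 : ℕ) : ℤ) = k + n + 2 + j by
      push_cast [hlk]; ring,
    show ((k - l + j : ℕ) : ℤ) = k - (l - j) by push_cast [hlk]; ring,
    h.right j (by omega) (by omega), h.left (l - j) (by omega) (by omega)]

/-- Two spline curves have the same jet of order `l` at a knot with `n + 1` copies if and only if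
the `l + 1` control points next to that knot agree. -/
theorem iteratedDeriv_eq_iff {u' : ℤ → ℝ} {A' τ' B' : ℝ} {k k' : ℕ} {J J' : ℤ} {M M' l : ℕ}
    {c c' : ℕ → ℂ} (hu : Monotone u) (hu' : Monotone u')
    (h : IsKnotCluster u n k A τ B) (h' : IsKnotCluster u' n k' A' τ' B')
    (hA : τ - A = τ' - A') (hB : B - A = B' - A')
    (hJ : ∀ i, pieceBasis u J (n + 1) i τ = if i = (k : ℤ) then 1 else 0)
    (hJ' : ∀ i, pieceBasis u' J' (n + 1) i τ' = if i = (k' : ℤ) then 1 else 0)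
    (hl : l ≤ n) (hk : l ≤ k) (hk' : l ≤ k') (hM : k ≤ M) (hM' : k' ≤ M')
    (hJl : (n + 1 + l : ℤ) ≤ J) (hJl' : (n + 1 + l : ℤ) ≤ J') (hJM : J ≤ M) (hJM' : J' ≤ M') :
    (∀ i ≤ l, iteratedDeriv i (pieceCurve u J (n + 1 + l) M c) τ =
      iteratedDeriv i (pieceCurve u' J' (n + 1 + l) M' c') τ') ↔
    ∀ j ≤ l, c (k - l + j) = c' (k' - l + j) := by
  induction l generalizing c c' with
  | zero =>
    simp only [Nat.le_zero, forall_eq, iteratedDeriv_zero]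
    rw [h.pieceCurve_eq hJ hl hk hM, h'.pieceCurve_eq hJ' hl hk' hM']
    simp [bernsteinPolynomial]
  | succ l ih =>
    have hAB : B - A ≠ 0 := by linarith [h.lt]
    have e1 : deriv (pieceCurve u J (n + 1 + (l + 1)) M c) =
        pieceCurve u J (n + 1 + l) M (derivCoeff u (n + 1 + l + 1) c) := funext fun x =>
      (hasDerivAt_pieceCurve_succ hu (d := n + 1 + l) (by push_cast at hJl ⊢; omega) hJM c x).deriv
    have e2 : deriv (pieceCurve u' J' (n + 1 + (l + 1)) M' c') =
        pieceCurve u' J' (n + 1 + l) M' (derivCoeff u' (n + 1 + l + 1) c') := funext fun x =>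
      (hasDerivAt_pieceCurve_succ hu' (d := n + 1 + l) (by push_cast at hJl' ⊢; omega) hJM' c' x).deriv
    have ih := @ih (derivCoeff u (n + 1 + l + 1) c) (derivCoeff u' (n + 1 + l + 1) c')
      (by omega) (by omega) (by omega) (by push_cast at hJl; omega) (by push_cast at hJl'; omega)
    have hd : (((n + 1 + l + 1 : ℕ) : ℝ) / (B - A)) ≠ 0 := div_ne_zero (by positivity) hAB
    -- The induction hypothesis for the derivatives: derivatives of order 1 to `l + 1` agree exactly
    -- when consecutive differences of control points do.
    have ih' : (∀ i ≤ l, iteratedDeriv (i + 1) (pieceCurve u J (n + 1 + (l + 1)) M c) τ =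
        iteratedDeriv (i + 1) (pieceCurve u' J' (n + 1 + (l + 1)) M' c') τ') ↔
        ∀ j ≤ l, c (k - (l + 1) + (j + 1)) - c (k - (l + 1) + j) =
          c' (k' - (l + 1) + (j + 1)) - c' (k' - (l + 1) + j) := by
      simp only [iteratedDeriv_succ', e1, e2]
      rw [ih]
      refine forall_congr' fun j => forall_congr' fun hj => ?_
      rw [h.derivCoeff_eq (by omega) (by omega) c hj, h'.derivCoeff_eq (by omega) (by omega) c' hj,
        ← hB, smul_right_inj hd, show k - l + j - 1 = k - (l + 1) + j by omega,
        show k' - l + j - 1 = k' - (l + 1) + j by omega,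
        show k - l + j = k - (l + 1) + (j + 1) by omega,
        show k' - l + j = k' - (l + 1) + (j + 1) by omega]
    have h0 := h.pieceCurve_eq hJ hl hk hM c
    have h0' := h'.pieceCurve_eq hJ' hl hk' hM' c'
    rw [← hA, ← hB] at h0'
    constructor
    · intro H
      have H0 := H 0 (by omega)
      rw [iteratedDeriv_zero, iteratedDeriv_zero, h0, h0', ← sub_eq_zero,
        ← Finset.sum_sub_distrib] at H0
      have H1 := ih'.1 fun i hi => H (i + 1) (by omega)
      have H2 : ∀ j ≤ l + 1, c (k - (l + 1) + j) - c' (k' - (l + 1) + j) =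
          c (k - (l + 1)) - c' (k' - (l + 1)) := by
        intro j
        induction j with
        | zero => intro _; rfl
        | succ j ihj =>
          intro hj
          rw [← ihj (by omega)]
          linear_combination H1 j (by omega)
      -- The offset between the two families is constant by `H2`. Bernstein polynomials sum to 1, so
      -- this constant is the difference of the two values at the knots, which is zero.
      have H3 : c (k - (l + 1)) - c' (k' - (l + 1)) = 0 := by
        rw [← H0, Finset.sum_congr rfl fun j hj => by
          rw [← smul_sub, H2 j (by rw [Finset.mem_range] at hj; omega)], ← Finset.sum_smul,
          ← Polynomial.eval_finsetSum, bernsteinPolynomial.sum]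
        simp
      intro j hj
      rw [← sub_eq_zero, H2 j hj, H3]
    · intro H i hi
      rcases i with _ | i
      · rw [iteratedDeriv_zero, iteratedDeriv_zero, h0, h0']
        exact Finset.sum_congr rfl fun j hj => by
          rw [H j (by rw [Finset.mem_range] at hj; omega)]
      · exact ih'.2 (fun j hj => by rw [H j (by omega), H (j + 1) (by omega)]) i (by omega)

end IsKnotCluster

/-! ### Gluing two smooth functions at a point -/

theorem hasDerivAt_ite_lt {F G F' G' : ℝ → ℂ} {a : ℝ} (hF : ∀ x, HasDerivAt F (F' x) x)
    (hG : ∀ x, HasDerivAt G (G' x) x) (h0 : F a = G a) (h1 : F' a = G' a) (x : ℝ) :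
    HasDerivAt (fun x => if x < a then F x else G x) (if x < a then F' x else G' x) x := by
  rcases lt_trichotomy x a with hx | rfl | hx
  · rw [if_pos hx]
    exact (hF x).congr_of_eventuallyEq ((eventually_lt_nhds hx).mono fun y hy => if_pos hy)
  · rw [if_neg (lt_irrefl x), ← hasDerivWithinAt_univ, ← Set.Iic_union_Ici (a := x)]
    refine HasDerivWithinAt.union ?_ ?_
    · rw [← h1]
      refine (hF x).hasDerivWithinAt.congr (fun y hy => ?_) ?_
      · rcases (Set.mem_Iic.1 hy).lt_or_eq with h | rfl
        · exact if_pos h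
        · simp [h0]
      · simp [h0]
    · refine (hG x).hasDerivWithinAt.congr (fun y hy => ?_) ?_
      · exact if_neg (not_lt.2 hy)
      · simp
  · rw [if_neg hx.not_gt]
    exact (hG x).congr_of_eventuallyEq ((eventually_gt_nhds hx).mono fun y hy => if_neg hy.not_gt)

theorem contDiff_ite_lt {n : ℕ} {F G : ℝ → ℂ} {a : ℝ} (hF : ContDiff ℝ n F) (hG : ContDiff ℝ n G)
    (h : ∀ i ≤ n, iteratedDeriv i F a = iteratedDeriv i G a) :
    ContDiff ℝ n (fun x => if x < a then F x else G x) := by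
  induction n generalizing F G with
  | zero =>
    rw [Nat.cast_zero, contDiff_zero] at *
    have h0 := h 0 le_rfl
    rw [iteratedDeriv_zero, iteratedDeriv_zero] at h0
    refine Continuous.if (fun x hx => ?_) hF hG
    rw [show {x : ℝ | x < a} = Set.Iio a from rfl, frontier_Iio, Set.mem_singleton_iff] at hx
    rw [hx, h0]
  | succ n ih =>
    push_cast at *
    rw [contDiff_succ_iff_deriv] at hF hG ⊢
    have key := hasDerivAt_ite_lt (a := a) (fun x => (hF.1 x).hasDerivAt)
      (fun x => (hG.1 x).hasDerivAt) (by simpa using h 0 (by omega))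
      (by simpa using h 1 (by omega))
    refine ⟨fun x => (key x).differentiableAt, fun h => absurd h (by simp), ?_⟩
    rw [show deriv (fun x => if x < a then F x else G x) = _ from funext fun x => (key x).deriv]
    refine ih hF.2.2 hG.2.2 fun i hi => ?_
    rw [← iteratedDeriv_succ', ← iteratedDeriv_succ']
    exact h (i + 1) (by omega)

/-- Two functions glued at `a` form a `C^n` function if and only if their jets at `a` agree. -/
theorem contDiffAt_ite_lt_iff {n : ℕ} {F G : ℝ → ℂ} {a : ℝ} (hF : ContDiff ℝ n F)
    (hG : ContDiff ℝ n G) :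
    (F a = G a ∧ ContDiffAt ℝ n (fun x => if x < a then F x else G x) a) ↔
      ∀ i ≤ n, iteratedDeriv i F a = iteratedDeriv i G a := by
  refine ⟨fun ⟨h0, h⟩ i hi => ?_, fun h => ⟨by simpa using h 0 (Nat.zero_le _),
    (contDiff_ite_lt hF hG h).contDiffAt⟩⟩
  have hi' : (i : WithTop ℕ∞) ≤ n := by exact_mod_cast hi
  -- Derivatives at `a` can be computed within a half line. The glued function is `G` on `Ici a`,
  -- and it is `F` on `Iic a`, including the point `a` because `F a = G a`.
  rw [← iteratedDerivWithin_eq_iteratedDeriv (uniqueDiffOn_Iic a)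
      (hF.contDiffAt.of_le hi') (Set.mem_Iic.2 le_rfl),
    ← iteratedDerivWithin_eq_iteratedDeriv (uniqueDiffOn_Ici a)
      (hG.contDiffAt.of_le hi') (Set.mem_Ici.2 le_rfl)]
  have e1 := iteratedDerivWithin_eq_iteratedDeriv (uniqueDiffOn_Iic a)
      (h.of_le hi') (Set.mem_Iic.2 le_rfl)
  have e2 := iteratedDerivWithin_eq_iteratedDeriv (uniqueDiffOn_Ici a)
      (h.of_le hi') (Set.mem_Ici.2 le_rfl)
  rw [iteratedDerivWithin_congr (g := F) _ (Set.mem_Iic.2 le_rfl)] at e1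
  · rw [iteratedDerivWithin_congr (g := G) _ (Set.mem_Ici.2 le_rfl)] at e2
    · rw [e1, e2]
    · exact fun y hy => if_neg (not_lt.2 hy)
  · intro y hy
    rcases (Set.mem_Iic.1 hy).lt_or_eq with h | rfl
    · exact if_pos h
    · simp [h0]

/-! ### Knots, control points and end pieces of the PH curve -/

namespace PHBSpline

variable {n p : ℕ} (C : PHBSpline n p)

theorem monotone_s' : Monotone C.s' := fun _ _ h =>
  C.mono (Int.ediv_le_ediv (by positivity) (by omega))

theorem s'_eq (κ : ℤ) {j : ℤ} (h0 : 0 ≤ j) (hn : j ≤ n) : C.s' (κ * (n + 1) + 1 + j) = C.t κ := by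
  rw [s', knotsRho, show κ * ((n : ℤ) + 1) + 1 + j - 1 = j + κ * (n + 1) by ring,
    Int.add_mul_ediv_right _ _ (by positivity), Int.ediv_eq_zero_of_lt h0 (by omega), zero_add]

theorem s'_succ (i : ℤ) : C.s' (i + 1) = C.s i := by
  rw [s', s, knotsRho, knotsNu, add_sub_cancel_right]

/-- Because of the extra knot at the front of `ρ`, the copies of `t κ` have indices `κ(n+1) + 1` to
`(κ+1)(n+1)`; so `κ(n+1)` is the last copy of the previous knot. -/
theorem isKnotCluster {κ : ℕ} (h : C.t (κ - 1) < C.t (κ + 1)) :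
    IsKnotCluster C.s' n ((κ * (n + 1) : ℕ) : ℤ) (C.t (κ - 1)) (C.t κ) (C.t (κ + 1)) where
  left j h0 hn := by
    rw [← C.s'_eq (κ - 1) (j := n - j) (by omega) (by omega)]
    congr 1; push_cast; ring
  mid j h0 hn := by
    rw [← C.s'_eq κ h0 hn]
    congr 1
  right j h0 hn := by
    rw [← C.s'_eq (κ + 1) h0 hn]
    congr 1; push_cast; ring
  lt := h

theorem legVector_eq (i : ℕ) : C.legVector i = C.pc i := by
  rw [legVector]
  split_ifs with h
  · rfl
  · have h1 : C.s' (i + 2 * n + 2) = C.s (i + 2 * n + 1) := by rw [← s'_succ]; congr 1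
    rw [rc, add_sub_cancel_left, smul_smul, h1, s'_succ, div_mul_div_cancel₀, div_self, one_smul]
    · positivity
    · rwa [h1, s'_succ, ← sub_eq_zero] at h

theorem derivCoeff_rc {i : ℕ} (h : C.s' (i + 1) ≠ C.s' (i + 2 * n + 2)) :
    derivCoeff C.s' (2 * n + 1) C.rc (i + 1) = C.pc i := by
  have h1 : C.s' (i + 2 * n + 2) = C.s (i + 2 * n + 1) := by rw [← s'_succ]; congr 1
  have h2 : C.s' ((i + 1 : ℕ) + (2 * n + 1 : ℕ)) = C.s (i + 2 * n + 1) := by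
    rw [← s'_succ]; congr 1; push_cast; ring
  have h3 : C.s' ((i + 1 : ℕ) : ℤ) = C.s i := by rw [← s'_succ]; congr 1
  rw [derivCoeff, h2, h3, Nat.add_sub_cancel, rc, add_sub_cancel_left, smul_smul, Nat.cast_add,
    Nat.cast_mul, Nat.cast_ofNat, Nat.cast_one, div_mul_div_cancel₀, div_self, one_smul]
  · positivity
  · rwa [h1, s'_succ, ne_comm, ← sub_ne_zero] at h

/-- Telescoping of the recursion for `r_i`; this is where the sums in the closure condition come
from. -/
theorem rc_sub_rc {i i' : ℕ} (h : i ≤ i') :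
    C.rc i' - C.rc i = (1 / (2 * n + 1) : ℝ) •
      ∑ j ∈ Finset.Ico i i', (C.s (j + 2 * n + 1) - C.s j) • C.pc j := by
  induction i', h using Nat.le_induction with
  | base => simp
  | succ i' h ih =>
    rw [Finset.sum_Ico_succ_top h, smul_add, ← ih, rc, smul_smul, one_div_mul_eq_div]
    abel

/-- The polynomial which `r` agrees with on the knot interval `J` of `ρ`. -/
noncomputable def piece (J : ℕ) (x : ℝ) : ℂ :=
  pieceCurve C.s' J (2 * n + 1) (C.q + 1) C.rc x

theorem contDiff_piece (J : ℕ) {m : WithTop ℕ∞} : ContDiff ℝ m (C.piece J) :=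
  contDiff_pieceCurve _ _ _ _ _

theorem r_eq_piece_start (hnp : n ≤ p) {x : ℝ} (h1 : C.t n ≤ x) (h2 : x < C.t (n + 1)) :
    C.r x = C.piece (n * (n + 1) + n + 1) x := by
  refine bsplineCurve_eq_pieceCurve C.monotone_s' (Or.inr ⟨?_, ?_, ?_⟩) _ _ _
  · have : C.t (n + 1) ≤ C.t (p + 1) := C.mono (by omega)
    exact (h2.trans_le this).ne
  · have := C.s'_eq n (j := n) (by omega) le_rfl
    rw [← this] at h1
    convert h1 using 2
    push_cast; ring
  · have := C.s'_eq (n + 1) (j := 0) le_rfl (by omega)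
    rw [← this] at h2
    convert h2 using 2
    push_cast; ring

theorem r_eq_piece_end {x : ℝ} (h1 : C.t p < x) (h2 : x ≤ C.t (p + 1)) :
    C.r x = C.piece ((p + 1) * (n + 1)) x := by
  have e1 : C.s' (((p + 1) * (n + 1) : ℕ) : ℤ) = C.t p := by
    rw [← C.s'_eq p (j := n) (by omega) le_rfl]
    congr 1; push_cast; ring
  have e2 : C.s' ((((p + 1) * (n + 1) : ℕ) : ℤ) + 1) = C.t (p + 1) := by
    rw [← C.s'_eq (p + 1) (j := 0) le_rfl (by omega)]
    congr 1
  refine bsplineCurve_eq_pieceCurve C.monotone_s' ?_ _ _ _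
  rw [e1, e2]
  -- At `x = b` the knot interval is closed on the right, so the last piece also gives the end
  -- value.
  rcases h2.eq_or_lt with h | h
  · exact Or.inl ⟨h, h1, h2⟩
  · exact Or.inr ⟨h.ne, h1.le, h⟩

theorem piece_eq {κ J : ℕ} (h : C.t (κ - 1) < C.t (κ + 1))
    (hJ : ∀ i, pieceBasis C.s' J (n + 1) i (C.t κ) =
      if i = ((κ * (n + 1) : ℕ) : ℤ) then 1 else 0)
    (hκ : 1 ≤ κ) (hM : κ * (n + 1) ≤ C.q + 1) :
    C.piece J (C.t κ) = ∑ k ∈ Finset.range (n + 1),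
      (bernsteinPolynomial ℝ n k).eval ((C.t κ - C.t (κ - 1)) / (C.t (κ + 1) - C.t (κ - 1))) •
        C.rc ((κ - 1) * (n + 1) + k + 1) := by
  obtain ⟨κ, rfl⟩ := Nat.exists_eq_add_of_le' hκ
  have hn : (κ + 1) * (n + 1) = κ * (n + 1) + n + 1 := by ring
  rw [piece, show 2 * n + 1 = n + 1 + n by ring,
    (C.isKnotCluster h).pieceCurve_eq hJ le_rfl (by omega) hM]
  refine Finset.sum_congr rfl fun k _ => ?_
  congr 2
  rw [Nat.add_sub_cancel]
  omega

theorem hasDerivAt_piece {κ J : ℕ} (h : C.t (κ - 1) < C.t (κ + 1))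
    (hJ : ∀ i, pieceBasis C.s' J (n + 1) i (C.t κ) =
      if i = ((κ * (n + 1) : ℕ) : ℤ) then 1 else 0)
    (hn : 1 ≤ n) (hκ : 1 ≤ κ) (hM : κ * (n + 1) ≤ C.q + 1)
    (hJ1 : 2 * n + 1 ≤ J) (hJM : J ≤ C.q + 1) :
    HasDerivAt (C.piece J) (∑ k ∈ Finset.range n, (bernsteinPolynomial ℝ (n - 1) k).eval
      ((C.t κ - C.t (κ - 1)) / (C.t (κ + 1) - C.t (κ - 1))) •
        C.pc ((κ - 1) * (n + 1) + k + 1)) (C.t κ) := by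
  have hd := hasDerivAt_pieceCurve_succ C.monotone_s' (J := J) (d := 2 * n) (M := C.q + 1)
    (by exact_mod_cast hJ1) (by exact_mod_cast hJM) C.rc (C.t κ)
  refine hd.congr_deriv ?_
  have hc := C.isKnotCluster h
  obtain ⟨κ, rfl⟩ := Nat.exists_eq_add_of_le' hκ
  have hn' : (κ + 1) * (n + 1) = κ * (n + 1) + n + 1 := by ring
  have key := hc.pieceCurve_eq hJ (Nat.sub_le n 1) (by omega) hM
    (derivCoeff C.s' (2 * n + 1) C.rc)
  -- The derivative has degree `2n`, that is `n - 1` above `n + 1`, hence Bernstein degree `n - 1`;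
  -- this needs `n ≥ 1`.
  rw [show n + 1 + (n - 1) = 2 * n by omega, show n - 1 + 1 = n by omega] at key
  rw [key]
  refine Finset.sum_congr rfl fun k hk => ?_
  rw [Finset.mem_range] at hk
  congr 1
  rw [Nat.add_sub_cancel, show (κ + 1) * (n + 1) - (n - 1) + k = κ * (n + 1) + k + 1 + 1 by omega]
  -- The support belonging to each `p_i` in the sum runs from a copy of the knot before `t κ` to a
  -- copy of the knot after it, so it is nondegenerate.
  refine C.derivCoeff_rc (ne_of_lt ?_)
  have e1 := hc.left (n - 1 - k) (by omega) (by omega)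
  have e2 := hc.right k (by omega) (by omega)
  calc C.s' ((κ * (n + 1) + k + 1 : ℕ) + 1) = C.t ((κ + 1 : ℕ) - 1) := by
        rw [← e1]; congr 1; push_cast; ring
    _ < C.t ((κ + 1 : ℕ) + 1) := h
    _ = C.s' ((κ * (n + 1) + k + 1 : ℕ) + 2 * n + 2) := by
        rw [← e2]; congr 1; push_cast; ring

end PHBSpline

/-! ### Clamped and closed curves -/

namespace PHBSpline

variable {n p : ℕ} (C : PHBSpline n p)

theorem start_spacing : C.t (n - 1) < C.t (n + 1) :=
  (C.mono (by omega : (n : ℤ) - 1 ≤ n)).trans_lt C.start_lt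

theorem end_spacing : C.t ((p + 1 : ℕ) - 1) < C.t ((p + 1 : ℕ) + 1) := by
  push_cast
  rw [add_sub_cancel_right]
  exact C.end_lt.trans_le (C.mono (by omega))

theorem pieceBasis_start (i : ℤ) :
    pieceBasis C.s' (n * (n + 1) + n + 1 : ℕ) (n + 1) i (C.t n) =
      if i = ((n * (n + 1) : ℕ) : ℤ) then 1 else 0 := by
  have h := (C.isKnotCluster C.start_spacing).pieceBasis_right C.start_lt le_rfl i
  push_cast at h ⊢
  rw [h]
  congr 1
  rw [eq_iff_iff]
  omega

theorem pieceBasis_end (i : ℤ) :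
    pieceBasis C.s' ((p + 1) * (n + 1) : ℕ) (n + 1) i (C.t (p + 1 : ℕ)) =
      if i = (((p + 1) * (n + 1) : ℕ) : ℤ) then 1 else 0 := by
  refine (C.isKnotCluster C.end_spacing).pieceBasis_left ?_ le_rfl i
  push_cast
  rw [add_sub_cancel_right]
  exact C.end_lt

theorem index_bounds (hn : 1 ≤ n) (hnp : n ≤ p) :
    n * (n + 1) + n + 1 ≤ C.q + 1 ∧ (p + 1) * (n + 1) ≤ C.q + 1 ∧
      2 * n + 1 ≤ n * (n + 1) + n + 1 ∧ 2 * n + 1 ≤ (p + 1) * (n + 1) := by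
  rw [q]
  refine ⟨?_, ?_, ?_, ?_⟩ <;> nlinarith [mul_le_mul hnp hn (by omega) (by omega)]

theorem a_lt_b (hnp : n ≤ p) : C.a < C.b :=
  C.start_lt.trans_le (C.mono (by omega))

theorem r_a_eq (hnp : n ≤ p) : C.r C.a = C.piece (n * (n + 1) + n + 1) C.a :=
  C.r_eq_piece_start hnp le_rfl C.start_lt

theorem r_b_eq : C.r C.b = C.piece ((p + 1) * (n + 1)) C.b :=
  C.r_eq_piece_end C.end_lt le_rfl

theorem hasDerivWithinAt_a_iff (hnp : n ≤ p) {v w : ℂ}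
    (h : HasDerivAt (C.piece (n * (n + 1) + n + 1)) w C.a) :
    HasDerivWithinAt C.r v (Set.Icc C.a C.b) C.a ↔ w = v := by
  have hw : HasDerivWithinAt C.r w (Set.Icc C.a C.b) C.a := by
    refine h.hasDerivWithinAt.congr_of_eventuallyEq ?_ (C.r_a_eq hnp)
    filter_upwards [self_mem_nhdsWithin,
      mem_nhdsWithin_of_mem_nhds (Iio_mem_nhds C.start_lt)] with x h1 h2
    exact C.r_eq_piece_start hnp h1.1 h2
  refine ⟨fun hv => ?_, fun h => h ▸ hw⟩
  exact (uniqueDiffOn_Icc (C.a_lt_b hnp) _ (Set.left_mem_Icc.2 (C.a_lt_b hnp).le)).eq_deriv _ hw hv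

theorem hasDerivWithinAt_b_iff (hnp : n ≤ p) {v w : ℂ}
    (h : HasDerivAt (C.piece ((p + 1) * (n + 1))) w C.b) :
    HasDerivWithinAt C.r v (Set.Icc C.a C.b) C.b ↔ w = v := by
  have hw : HasDerivWithinAt C.r w (Set.Icc C.a C.b) C.b := by
    refine h.hasDerivWithinAt.congr_of_eventuallyEq ?_ C.r_b_eq
    filter_upwards [self_mem_nhdsWithin,
      mem_nhdsWithin_of_mem_nhds (Ioi_mem_nhds C.end_lt)] with x h1 h2
    exact C.r_eq_piece_end h2 h1.2
  refine ⟨fun hv => ?_, fun h => h ▸ hw⟩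
  exact (uniqueDiffOn_Icc (C.a_lt_b hnp) _ (Set.right_mem_Icc.2 (C.a_lt_b hnp).le)).eq_deriv _ hw hv

theorem isClamped_iff (hn : 1 ≤ n) (hnp : n ≤ p) :
    C.IsClamped ↔
      ((∑ k ∈ Finset.range (n + 1), (bernsteinPolynomial ℝ n k).eval
          ((C.t n - C.t (n - 1)) / (C.t (n + 1) - C.t (n - 1))) •
            C.rc ((n - 1) * (n + 1) + k + 1) = C.rc 0 ∧
        ∑ k ∈ Finset.range n, (bernsteinPolynomial ℝ (n - 1) k).eval
          ((C.t n - C.t (n - 1)) / (C.t (n + 1) - C.t (n - 1))) •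
            C.pc ((n - 1) * (n + 1) + k + 1) = C.pc 0) ∧
       (∑ k ∈ Finset.range (n + 1), (bernsteinPolynomial ℝ n k).eval
          ((C.t (p + 1) - C.t p) / (C.t (p + 2) - C.t p)) •
            C.rc (p * (n + 1) + k + 1) = C.rc (C.q + 1) ∧
        ∑ k ∈ Finset.range n, (bernsteinPolynomial ℝ (n - 1) k).eval
          ((C.t (p + 1) - C.t p) / (C.t (p + 2) - C.t p)) •
            C.pc (p * (n + 1) + k + 1) = C.pc C.q)) := by
  obtain ⟨b1, b2, b3, b4⟩ := C.index_bounds hn hnp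
  have vs := C.piece_eq C.start_spacing C.pieceBasis_start hn (by omega)
  have ds := C.hasDerivAt_piece C.start_spacing C.pieceBasis_start hn hn (by omega) b3 b1
  have ve := C.piece_eq C.end_spacing C.pieceBasis_end (by omega) b2
  have de := C.hasDerivAt_piece C.end_spacing C.pieceBasis_end hn (by omega) b2 b4 b2
  have e1 : ((p + 1 : ℕ) : ℤ) - 1 = p := by push_cast; ring
  have e2 : ((p + 1 : ℕ) : ℤ) + 1 = p + 2 := by push_cast; ring
  rw [e1, e2, Nat.add_sub_cancel, Nat.cast_add, Nat.cast_one] at ve de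
  rw [IsClamped, C.hasDerivWithinAt_a_iff hnp ds, C.hasDerivWithinAt_b_iff hnp de,
    C.r_a_eq hnp, C.r_b_eq, a, b, vs, ve, legVector_eq, legVector_eq]
  tauto

theorem isClosedSmooth_iff_iteratedDeriv (hnp : n ≤ p) :
    C.IsClosedSmooth ↔ ∀ i ≤ n, iteratedDeriv i (C.piece ((p + 1) * (n + 1))) C.b =
      iteratedDeriv i (C.piece (n * (n + 1) + n + 1)) C.a := by
  have hab := C.a_lt_b hnp
  have key := contDiffAt_ite_lt_iff (n := n) (a := C.a)
    (F := fun x => C.piece ((p + 1) * (n + 1)) (x + (C.b - C.a)))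
    (G := C.piece (n * (n + 1) + n + 1))
    ((C.contDiff_piece _).comp (contDiff_id.add contDiff_const)) (C.contDiff_piece _)
  simp only [iteratedDeriv_comp_add_const, add_sub_cancel] at key
  rw [← key, IsClosedSmooth, ← C.r_b_eq, ← C.r_a_eq hnp, eq_comm]
  suffices h : (fun x => if x < C.a then C.r (x + (C.b - C.a)) else C.r x) =ᶠ[𝓝 C.a]
      fun x => if x < C.a then C.piece ((p + 1) * (n + 1)) (x + (C.b - C.a))
        else C.piece (n * (n + 1) + n + 1) x from
    and_congr Iff.rfl ⟨fun H => H.congr_of_eventuallyEq h.symm, fun H => H.congr_of_eventuallyEq h⟩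
  filter_upwards [Iio_mem_nhds C.start_lt,
    Ioi_mem_nhds (show C.a - (C.b - C.t p) < C.a by linarith [show C.t p < C.b from C.end_lt])]
    with x h1 h2
  rw [Set.mem_Ioi] at h2
  split_ifs with hx
  · exact C.r_eq_piece_end (by linarith) (by linarith [show C.t (p + 1) = C.b from rfl])
  · exact C.r_eq_piece_start hnp (not_lt.1 hx) h1

/-- The two spacing equalities say that the knot clusters at both ends are translates of each other,
which is what the comparison of jets requires. -/
theorem isClosedSmooth_iff_rc (hn : 1 ≤ n) (hnp : n ≤ p)
    (h1 : C.t (p + 1) - C.t p = C.t n - C.t (n - 1))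
    (h2 : C.t (p + 2) - C.t (p + 1) = C.t (n + 1) - C.t n) :
    C.IsClosedSmooth ↔
      ∀ j ≤ n, C.rc ((p + 1) * (n + 1) - n + j) = C.rc (n * (n + 1) - n + j) := by
  obtain ⟨b1, b2, b3, b4⟩ := C.index_bounds hn hnp
  rw [C.isClosedSmooth_iff_iteratedDeriv hnp]
  have e1 : ((p + 1 : ℕ) : ℤ) - 1 = p := by push_cast; ring
  have e2 : ((p + 1 : ℕ) : ℤ) + 1 = p + 2 := by push_cast; ring
  have e3 : ((p + 1 : ℕ) : ℤ) = p + 1 := by push_cast; ring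
  have := IsKnotCluster.iteratedDeriv_eq_iff (c := C.rc) (c' := C.rc) (M := C.q + 1)
    (M' := C.q + 1) (l := n) C.monotone_s' C.monotone_s'
    (C.isKnotCluster C.end_spacing) (C.isKnotCluster C.start_spacing)
    (by rw [e1, e3, h1]) (by rw [e1, e2]; linarith) C.pieceBasis_end C.pieceBasis_start le_rfl
    (by omega) (by omega) b2 (by omega) (by omega) (by omega) (by omega) (by omega)
  rw [← this, show n + 1 + n = 2 * n + 1 by ring, e3]
  rfl

end PHBSpline

theorem proposition1 (n : ℕ) (hn : 1 ≤ n) :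
    -- clamped case, `p = m`
    (∀ (m : ℕ), n ≤ m → ∀ (C : PHBSpline n m) (α β : ℝ),
      α = (C.t n - C.t (n - 1)) / (C.t (n + 1) - C.t (n - 1)) →
      β = (C.t (m + 1) - C.t m) / (C.t (m + 2) - C.t m) →
      (C.IsClamped ↔
        ((∑ k ∈ Finset.range (n + 1),
            (bernsteinPolynomial ℝ n k).eval α • C.rc ((n - 1) * (n + 1) + k + 1) = C.rc 0 ∧
          ∑ k ∈ Finset.range n,
            (bernsteinPolynomial ℝ (n - 1) k).eval α • C.pc ((n - 1) * (n + 1) + k + 1) = C.pc 0) ∧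
         (∑ k ∈ Finset.range (n + 1),
            (bernsteinPolynomial ℝ n k).eval β • C.rc (m * (n + 1) + k + 1) = C.rc (C.q + 1) ∧
          ∑ k ∈ Finset.range n,
            (bernsteinPolynomial ℝ (n - 1) k).eval β • C.pc (m * (n + 1) + k + 1) =
              C.pc C.q)))) ∧
    -- closed case, `p = m + n`
    (∀ (m : ℕ) (C : PHBSpline n (m + n)),
      (∀ k : ℕ, k = n ∨ k = n + 1 →
        C.t (m + 1 + k) - C.t (m + k) = C.t k - C.t (k - 1)) →
      (C.IsClosedSmooth ↔
        ∀ k ≤ n, ∑ j ∈ Finset.Ico (n * (n + 1) - k) ((m + n + 1) * (n + 1) - k),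
          (C.s (j + 2 * n + 1) - C.s j) • C.pc j = 0)) := by
  refine ⟨?_, fun m C h => ?_⟩
  · rintro m hm C α β rfl rfl
    exact C.isClamped_iff hn hm
  · have h1 := h n (Or.inl rfl)
    have h2 := h (n + 1) (Or.inr rfl)
    push_cast at h1 h2
    rw [C.isClosedSmooth_iff_rc hn (by omega)
      (by rw [← h1]; push_cast; congr 2; ring)
      (by rw [add_sub_cancel_right] at h2; rw [← h2]; push_cast; congr 2; ring)]
    have hle : n ≤ n * (n + 1) := Nat.le_mul_of_pos_right _ (by omega)
    have hmul : n * (n + 1) ≤ (m + n + 1) * (n + 1) := Nat.mul_le_mul_right _ (by omega)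
    have hc : (1 / (2 * n + 1) : ℝ) ≠ 0 := by positivity
    -- The substitution `j = n - k` matches control point pairs with sums. Since `k ≤ n ≤ n(n+1)`,
    -- no subtraction is truncated.
    have key : ∀ k ≤ n, (C.rc ((m + n + 1) * (n + 1) - n + (n - k)) =
        C.rc (n * (n + 1) - n + (n - k)) ↔
        ∑ j ∈ Finset.Ico (n * (n + 1) - k) ((m + n + 1) * (n + 1) - k),
          (C.s (j + 2 * n + 1) - C.s j) • C.pc j = 0) := fun k hk => by
      rw [show (m + n + 1) * (n + 1) - n + (n - k) = (m + n + 1) * (n + 1) - k by omega,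
        show n * (n + 1) - n + (n - k) = n * (n + 1) - k by omega, ← sub_eq_zero,
        C.rc_sub_rc (by omega), smul_eq_zero_iff_right hc]
    refine ⟨fun H k hk => (key k hk).1 (H _ (by omega)), fun H j hj => ?_⟩
    have := (key (n - j) (by omega)).2 (H _ (by omega))
    rwa [show n - (n - j) = j by omega] at this
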